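/- Let $N\in\mathbb N$ and $1\le p<\infty$. For $\psi:\mathbb R^N\to\mathbb R$, $h\in\mathbb R^N\setminus\{0\}$ put $\delta_h\psi(x)=\psi(x+h)-\psi(x)$ and $\delta_h^2\psi(x)=\delta_h(\delta_h\psi)(x)=\psi(x+2h)-2\psi(x+h)+\psi(x)$. For $0<\alpha<2$ let $\mathcal B^{\alpha,p}_\infty(\mathbb R^N)$ be the space of all $\psi\in L^p(\mathbb R^N)$ with $$[\psi]_{\mathcal B^{\alpha,p}_\infty(\mathbb R^N)}:=\sup_{|h|>0}\left\|\frac{\delta_h^2\psi}{|h|^\alpha}\right\|_{L^p(\mathbb R^N)}<+\infty ,\qquad \|\psi\|_{\mathcal B^{\alpha,p}_\infty(\mathbb R^N)}:=\|\psi\|_{L^p(\mathbb R^N)}+[\psi]_{\mathcal B^{\alpha,p}_\infty(\mathbb R^N)},$$ and let $W^{1,p}(\mathbb R^N)$ be the space of all $\psi\in L^p(\mathbb R^N)$ whose distributional gradient $\nabla\psi$ belongs to $L^p(\mathbb R^N)$, with norm $\|\psi\|_{L^p(\mathbb R^N)}+\|\nabla\psi\|_{L^p(\mathbb R^N)}$.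 There is a constant $C=C(N,p)>0$ such that the following holds for every $1<\alpha<2$. 1. $\mathcal B^{\alpha,p}_\infty(\mathbb R^N)\hookrightarrow W^{1,p}(\mathbb R^N)$ continuously; that is, $\mathcal B^{\alpha,p}_\infty(\mathbb R^N)\subset W^{1,p}(\mathbb R^N)$ and, for some constant $K=K(N,p,\alpha)$, $\|\psi\|_{W^{1,p}(\mathbb R^N)}\le K\,\|\psi\|_{\mathcal B^{\alpha,p}_\infty(\mathbb R^N)}$ for all $\psi\in\mathcal B^{\alpha,p}_\infty(\mathbb R^N)$. 2. For every $\psi\in\mathcal B^{\alpha,p}_\infty(\mathbb R^N)$ we have $\nabla\psi\in L^p(\mathbb R^N)$ and $$\|\nabla\psi\|_{L^p(\mathbb R^N)}\le C\,\|\psi\|_{L^p(\mathbb R^N)}+\frac{C}{\alpha-1}\,[\psi]_{\mathcal B^{\alpha,p}_\infty(\mathbb R^N)} .$$ 3. For every $\psi\in\mathcal B^{\alpha,p}_\infty(\mathbb R^N)$, $$\sup_{|h|>0}\left\|\frac{\delta_h\nabla\psi}{|h|^{\alpha-1}}\right\|_{L^p(\mathbb R^N)}\le\frac{C}{(2-\alpha)(\alpha-1)}\,[\psi]_{\mathcal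 B^{\alpha,p}_\infty(\mathbb R^N)} .$$ -/

import Mathlib

open MeasureTheory
open scoped ENNReal NNReal ContDiff

namespace BesovNikolskii

/-- `G` is the weak (distributional) gradient of `ψ : ℝᴺ → ℝ`: both are locally integrable and
`∫ ψ ∂ᵥφ dx = - ∫ ⟨G, v⟩ φ dx` for every test function `φ ∈ C_c^∞(ℝᴺ)` and every direction `v`. -/
def HasWeakGradient {N : ℕ} (ψ : EuclideanSpace ℝ (Fin N) → ℝ)
    (G : EuclideanSpace ℝ (Fin N) → EuclideanSpace ℝ (Fin N)) : Prop :=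
  LocallyIntegrable ψ volume ∧ LocallyIntegrable G volume ∧
    ∀ φ : EuclideanSpace ℝ (Fin N) → ℝ, ContDiff ℝ ∞ φ → HasCompactSupport φ →
      ∀ v : EuclideanSpace ℝ (Fin N),
        ∫ x, ψ x * fderiv ℝ φ x v = - ∫ x, inner ℝ (G x) v * φ x

/-- Weak gradients are unique up to null sets. -/
theorem HasWeakGradient.ae_eq {N : ℕ} {ψ : EuclideanSpace ℝ (Fin N) → ℝ}
    {G G' : EuclideanSpace ℝ (Fin N) → EuclideanSpace ℝ (Fin N)}
    (h : HasWeakGradient ψ G) (h' : HasWeakGradient ψ G') : G =ᵐ[volume] G' := by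
  obtain ⟨-, hG, e⟩ := h
  obtain ⟨-, hG', e'⟩ := h'
  refine ae_eq_of_integral_contDiff_smul_eq hG hG' fun g hg hc => ?_
  have i1 : Integrable (fun x => g x • G x) volume :=
    hG.integrable_smul_left_of_hasCompactSupport hg.continuous hc
  have i2 : Integrable (fun x => g x • G' x) volume :=
    hG'.integrable_smul_left_of_hasCompactSupport hg.continuous hc
  refine ext_inner_left ℝ fun v => ?_
  rw [← integral_inner i1, ← integral_inner i2]
  have := (e g hg hc v).symm.trans (e' g hg hc v)
  simpa [inner_smul_right, mul_comm, real_inner_comm] using this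

/-- `ψ ∈ W^{1,p}(ℝᴺ)`: both `ψ` and its weak gradient are in `Lᵖ`. -/
def MemW1p {N : ℕ} (p : ℝ≥0∞) (ψ : EuclideanSpace ℝ (Fin N) → ℝ) : Prop :=
  MemLp ψ p volume ∧ ∃ G, HasWeakGradient ψ G ∧ MemLp G p volume

/-- The norm `‖ψ‖_{Lᵖ} + ‖∇ψ‖_{Lᵖ}` of `W^{1,p}(ℝᴺ)`. The infimum only ranges over versions of the
weak gradient that agree almost everywhere (it is `∞` if there is no weak gradient). -/
noncomputable def sobolevNorm {N : ℕ} (p : ℝ≥0∞) (ψ : EuclideanSpace ℝ (Fin N) → ℝ) : ℝ≥0∞ :=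
  ⨅ (G : EuclideanSpace ℝ (Fin N) → EuclideanSpace ℝ (Fin N)) (_ : HasWeakGradient ψ G),
    (eLpNorm ψ p volume + eLpNorm G p volume)

theorem sobolevNorm_eq {N : ℕ} (p : ℝ≥0∞) {ψ : EuclideanSpace ℝ (Fin N) → ℝ}
    {G : EuclideanSpace ℝ (Fin N) → EuclideanSpace ℝ (Fin N)} (h : HasWeakGradient ψ G) :
    sobolevNorm p ψ = eLpNorm ψ p volume + eLpNorm G p volume := by
  refine le_antisymm (iInf₂_le G h) (le_iInf₂ fun G' h' => ?_)
  rw [eLpNorm_congr_ae (h.ae_eq h')]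

/-- The first order Nikol'skii quantity `sup_{|h| > 0} ‖ δ_h f / |h|^β ‖_{Lᵖ(ℝᴺ)}`,
where `δ_h f (x) = f (x + h) - f x` is Mathlib's `fwdDiff h f`. -/
noncomputable def nikolskiiSeminorm {N : ℕ} {F : Type*} [NormedAddCommGroup F] [NormedSpace ℝ F]
    (β : ℝ) (p : ℝ≥0∞) (f : EuclideanSpace ℝ (Fin N) → F) : ℝ≥0∞ :=
  ⨆ (h : EuclideanSpace ℝ (Fin N)) (_ : h ≠ 0),
    eLpNorm (fun x => (‖h‖ ^ β)⁻¹ • fwdDiff h f x) p volume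

/-- The Besov-Nikol'skii seminorm `[ψ]_{B^{α,p}_∞} = sup_{|h| > 0} ‖ δ²_h ψ / |h|^α ‖_{Lᵖ(ℝᴺ)}`,
where `δ²_h ψ = δ_h (δ_h ψ)`, that is `δ²_h ψ (x) = ψ (x + 2 h) - 2 ψ (x + h) + ψ x`. -/
noncomputable def besovSeminorm {N : ℕ} (α : ℝ) (p : ℝ≥0∞)
    (ψ : EuclideanSpace ℝ (Fin N) → ℝ) : ℝ≥0∞ :=
  ⨆ (h : EuclideanSpace ℝ (Fin N)) (_ : h ≠ 0),
    eLpNorm (fun x => fwdDiff h (fwdDiff h ψ) x / ‖h‖ ^ α) p volume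

/-- `ψ ∈ B^{α,p}_∞(ℝᴺ)`. -/
def MemBesov {N : ℕ} (α : ℝ) (p : ℝ≥0∞) (ψ : EuclideanSpace ℝ (Fin N) → ℝ) : Prop :=
  MemLp ψ p volume ∧ besovSeminorm α p ψ < (⊤ : ℝ≥0∞)

/-- The norm `‖ψ‖_{Lᵖ} + [ψ]_{B^{α,p}_∞}` of `B^{α,p}_∞(ℝᴺ)`. -/
noncomputable def besovNorm {N : ℕ} (α : ℝ) (p : ℝ≥0∞)
    (ψ : EuclideanSpace ℝ (Fin N) → ℝ) : ℝ≥0∞ :=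
  eLpNorm ψ p volume + besovSeminorm α p ψ

end BesovNikolskii

/-! Everything rests on the telescoping identity `δ_{2v} ψ - 2 δ_v ψ = δ²_v ψ`. With `v = w /
2^(k+1)` it shows that consecutive dyadic quotients `2^k δ_{w/2^k} ψ` differ in `Lᵖ` by at most a
constant times `2^(k(1-α)) |w|^α [ψ]`, a geometric sequence because `α > 1`. Completeness of `Lᵖ`
gives a limit, which testing against smooth functions identifies as the weak derivative `∂_w ψ`.
Summing the series gives the central estimate `‖δ_w ψ - ∂_w ψ‖ ≤ |w|^α [ψ] / (α - 1)`
(`MemBesov.exists_weakDeriv`).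

Taking `w = e_i` bounds the gradient. Taking `w = |h| e_i` and applying `δ_h` bounds `|h| δ_h ∂_i ψ`
by `δ_h δ_w ψ` plus an error already controlled. Since `|w| = |h|`, the mixed difference reduces to
pure ones by polarization (`eLpNorm_fwdDiff_fwdDiff_le_of_norm_eq`). No blow-up at `α = 2` occurs,
so the factor `1/(2-α)` is only slack. -/

namespace BesovNikolskii

open Filter Topology

/-! ### Passing to the limit under test functions -/

/-- By Hölder's inequality, convergence in `Lᵖ` implies convergence of the integrals against a
function in the dual Lebesgue space. -/
theorem tendsto_integral_mul_of_tendsto_eLpNorm {X ι : Type*} [MeasurableSpace X] {μ : Measure X}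
    {l : Filter ι} {p q : ℝ≥0∞} [ENNReal.HolderConjugate p q] {F : ι → X → ℝ} {f φ : X → ℝ}
    (hF : ∀ i, MemLp (F i) p μ) (hf : MemLp f p μ) (hφ : MemLp φ q μ)
    (h : Tendsto (fun i => eLpNorm (F i - f) p μ) l (𝓝 0)) :
    Tendsto (fun i => ∫ x, F i x * φ x ∂μ) l (𝓝 (∫ x, f x * φ x ∂μ)) := by
  refine tendsto_integral_of_L1' _ (hf.aestronglyMeasurable.mul hφ.aestronglyMeasurable)
    (Eventually.of_forall fun i => (hF i).integrable_mul hφ) ?_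
  have h0 : Tendsto (fun i => eLpNorm (F i - f) p μ * eLpNorm φ q μ) l (𝓝 0) := by
    simpa using ENNReal.Tendsto.mul_const h (Or.inr hφ.eLpNorm_ne_top)
  refine tendsto_of_tendsto_of_tendsto_of_le_of_le tendsto_const_nhds h0 (fun i => zero_le) ?_
  intro i
  have e : ((fun x => F i x * φ x) - fun x => f x * φ x) = (F i - f) • φ := by
    ext x; simp [sub_mul]
  change eLpNorm ((fun x => F i x * φ x) - fun x => f x * φ x) 1 μ ≤ _
  rw [e]
  exact eLpNorm_smul_le_mul_eLpNorm hφ.aestronglyMeasurable ((hF i).sub hf).aestronglyMeasurable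

variable {N : ℕ}

local notation "E" => EuclideanSpace ℝ (Fin N)

/-- Difference quotients of a locally integrable function converge to its derivative in the sense
of distributions. -/
theorem tendsto_integral_differenceQuotient {ψ φ : E → ℝ} (hψ : LocallyIntegrable ψ volume)
    (hφ : ContDiff ℝ ∞ φ) (hc : HasCompactSupport φ) (w : E) :
    Tendsto (fun t : ℝ => ∫ x, (t⁻¹ • (ψ (x + t • w) - ψ x)) * φ x) (𝓝[>] 0)
      (𝓝 (-∫ x, ψ x * fderiv ℝ φ x w)) := by
  obtain ⟨C, hC⟩ := hφ.lipschitzWith_of_hasCompactSupport hc (by simp)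
  -- For `0 < t ≤ 1`, both `φ` and `φ (· - t w)` vanish off `K`, so truncating `ψ` to `K` makes it
  -- integrable without changing the integrals below.
  set K := Metric.cthickening ‖w‖ (tsupport φ)
  have hKc : IsCompact K := IsCompact.cthickening hc
  have hg : Integrable (K.indicator ψ) volume :=
    (hψ.integrableOn_isCompact hKc).integrable_indicator hKc.isClosed.measurableSet
  -- The direction is `-w` because translation invariance moves the shift by `t w` from `ψ` to a
  -- shift by `-t w` of `φ`.
  have key := hC.integral_inv_smul_sub_mul_tendsto_integral_lineDeriv_mul hg (-w)
  have hlim : ∫ x, lineDeriv ℝ φ x (-w) * K.indicator ψ x = -∫ x, ψ x * fderiv ℝ φ x w := by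
    rw [← integral_neg]
    refine integral_congr_ae (Eventually.of_forall fun x => ?_)
    have hd : DifferentiableAt ℝ φ x := hφ.differentiable (by simp) x
    simp only [hd.lineDeriv_eq_fderiv, map_neg]
    by_cases hx : x ∈ K
    · rw [Set.indicator_of_mem hx]; ring
    · have : fderiv ℝ φ x = 0 := by
        refine image_eq_zero_of_notMem_tsupport fun h => hx ?_
        exact Metric.self_subset_cthickening _ (tsupport_fderiv_subset ℝ h)
      simp [this]
  rw [hlim] at key
  refine key.congr' ?_
  filter_upwards [Ioc_mem_nhdsGT (zero_lt_one' ℝ)] with t ht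
  have i1 : Integrable (fun x => ψ x * φ x) volume := by
    simpa [mul_comm] using
      hψ.integrable_smul_left_of_hasCompactSupport hφ.continuous hc
  have hcs : HasCompactSupport fun x => φ (x + t • (-w)) :=
    hc.comp_homeomorph (Homeomorph.addRight (t • (-w)))
  have i2 : Integrable (fun x => ψ x * φ (x + t • (-w))) volume := by
    simpa [mul_comm] using
      hψ.integrable_smul_left_of_hasCompactSupport (g := fun x => φ (x + t • (-w)))
        (hφ.continuous.comp (by fun_prop)) hcs
  have i3 : Integrable (fun x => ψ (x + t • w) * φ x) volume := by
    simpa [add_assoc] using i2.comp_add_right (t • w)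
  have e3 : ∫ x, ψ (x + t • w) * φ x = ∫ x, ψ x * φ (x + t • (-w)) := by
    rw [← integral_add_right_eq_self (fun x => ψ x * φ (x + t • (-w))) (t • w)]
    simp [add_assoc]
  have hl : ∫ x, (t⁻¹ • (φ (x + t • (-w)) - φ x)) * K.indicator ψ x =
      ∫ x, t⁻¹ * (ψ x * φ (x + t • (-w)) - ψ x * φ x) := by
    refine integral_congr_ae (Eventually.of_forall fun x => ?_)
    by_cases hx : x ∈ K
    · simp only [Set.indicator_of_mem hx, smul_eq_mul]; ring
    · have h1 : φ x = 0 := image_eq_zero_of_notMem_tsupport fun h =>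
        hx (Metric.self_subset_cthickening _ h)
      have h2 : φ (x + t • (-w)) = 0 := image_eq_zero_of_notMem_tsupport fun h => by
        refine hx (Metric.mem_cthickening_of_dist_le x _ _ _ h ?_)
        rw [dist_eq_norm]
        simp only [smul_neg, sub_add_cancel_left, neg_neg, norm_smul, Real.norm_eq_abs,
          abs_of_pos ht.1]
        exact mul_le_of_le_one_left (norm_nonneg _) ht.2
      simp only [h1, h2, sub_self, smul_zero, mul_zero, zero_mul]
  have hr : ∫ x, (t⁻¹ • (ψ (x + t • w) - ψ x)) * φ x =
      ∫ x, t⁻¹ * (ψ (x + t • w) * φ x - ψ x * φ x) := by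
    refine integral_congr_ae (Eventually.of_forall fun x => ?_)
    simp only [smul_eq_mul]; ring
  rw [hl, hr, integral_const_mul, integral_const_mul, integral_sub i2 i1, integral_sub i3 i1, e3]

/-! ### Translations and finite differences in `Lᵖ` -/

theorem memLp_comp_add_right {F : Type*} [NormedAddCommGroup F] {p : ℝ≥0∞} {f : E → F}
    (hf : MemLp f p volume) (h : E) : MemLp (fun x => f (x + h)) p volume :=
  hf.comp_measurePreserving (measurePreserving_add_right volume h)

theorem eLpNorm_comp_add_right {F : Type*} [NormedAddCommGroup F] {p : ℝ≥0∞} {f : E → F}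
    (hf : AEStronglyMeasurable f volume) (h : E) :
    eLpNorm (fun x => f (x + h)) p volume = eLpNorm f p volume :=
  eLpNorm_comp_measurePreserving hf (measurePreserving_add_right volume h)

theorem eLpNorm_fwdDiff_le {F : Type*} [NormedAddCommGroup F] {p : ℝ≥0∞} (hp : 1 ≤ p) {f : E → F}
    (hf : AEStronglyMeasurable f volume) (h : E) :
    eLpNorm (fwdDiff h f) p volume ≤ 2 * eLpNorm f p volume := by
  have hm : AEStronglyMeasurable (fun x => f (x + h)) volume :=
    hf.comp_measurePreserving (measurePreserving_add_right volume h)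
  refine (eLpNorm_sub_le hm hf hp).trans ?_
  rw [eLpNorm_comp_add_right hf, two_mul]

theorem memLp_fwdDiff {F : Type*} [NormedAddCommGroup F] {p : ℝ≥0∞} {f : E → F}
    (hf : MemLp f p volume) (h : E) : MemLp (fwdDiff h f) p volume :=
  (memLp_comp_add_right hf h).sub hf

theorem eLpNorm_fwdDiff_fwdDiff_le (α : ℝ) (p : ℝ≥0∞) (ψ : E → ℝ) (h : E) :
    eLpNorm (fwdDiff h (fwdDiff h ψ)) p volume ≤
      ENNReal.ofReal (‖h‖ ^ α) * besovSeminorm α p ψ := by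
  rcases eq_or_ne h 0 with rfl | hh
  · have : fwdDiff (0 : E) (fwdDiff 0 ψ) = 0 := by ext x; simp [fwdDiff]
    simp [this]
  · have hpos : 0 < ‖h‖ ^ α := Real.rpow_pos_of_pos (norm_pos_iff.2 hh) _
    have e : fwdDiff h (fwdDiff h ψ) =
        (‖h‖ ^ α) • (fun x => fwdDiff h (fwdDiff h ψ) x / ‖h‖ ^ α) := by
      ext x; simp only [Pi.smul_apply, smul_eq_mul]; field_simp
    conv_lhs => rw [e]
    rw [eLpNorm_const_smul, Real.enorm_of_nonneg hpos.le]
    gcongr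
    exact le_iSup₂ (f := fun (h : E) (_ : h ≠ 0) =>
      eLpNorm (fun x => fwdDiff h (fwdDiff h ψ) x / ‖h‖ ^ α) p volume) h hh

/-- Mixed second differences along two vectors of the same length are controlled by pure second
differences, since `δ_h δ_k ψ = δ²_a ψ - δ²_b ψ (· + k)` for `a = (h + k) / 2`, `b = (h - k) / 2`. -/
theorem eLpNorm_fwdDiff_fwdDiff_le_of_norm_eq {α : ℝ} (hα : 0 ≤ α) {p : ℝ≥0∞} (hp : 1 ≤ p)
    {ψ : E → ℝ} (hψ : AEStronglyMeasurable ψ volume) {h k : E} (hk : ‖k‖ = ‖h‖) :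
    eLpNorm (fwdDiff h (fwdDiff k ψ)) p volume ≤
      2 * ENNReal.ofReal (‖h‖ ^ α) * besovSeminorm α p ψ := by
  have hm : ∀ (v : E) (f : E → ℝ), AEStronglyMeasurable f volume →
      AEStronglyMeasurable (fwdDiff v f) volume := fun v f hf =>
    (hf.comp_measurePreserving (measurePreserving_add_right volume v)).sub hf
  set a : E := (2⁻¹ : ℝ) • (h + k)
  set b : E := (2⁻¹ : ℝ) • (h - k)
  have ha : ‖a‖ ≤ ‖h‖ := by
    rw [norm_smul]; norm_num; linarith [norm_add_le h k]
  have hb : ‖b‖ ≤ ‖h‖ := by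
    rw [norm_smul]; norm_num; linarith [norm_sub_le h k]
  have bound : ∀ v : E, ‖v‖ ≤ ‖h‖ → eLpNorm (fwdDiff v (fwdDiff v ψ)) p volume ≤
      ENNReal.ofReal (‖h‖ ^ α) * besovSeminorm α p ψ := fun v hv =>
    (eLpNorm_fwdDiff_fwdDiff_le α p ψ v).trans (by gcongr)
  have e : fwdDiff h (fwdDiff k ψ) =
      fwdDiff a (fwdDiff a ψ) - fun x => fwdDiff b (fwdDiff b ψ) (x + k) := by
    ext x
    have h1 : x + a + a = x + h + k := by simp only [a]; module
    have h2 : x + a + b = x + h := by simp only [a, b]; module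
    have h3 : x + k + b = x + a := by simp only [a, b]; module
    simp only [fwdDiff, Pi.sub_apply, h1, h3, h2]
    ring
  have hbm := hm b _ (hm b _ hψ)
  rw [e]
  refine (eLpNorm_sub_le (hm a _ (hm a _ hψ))
    (hbm.comp_measurePreserving (measurePreserving_add_right volume k)) hp).trans ?_
  rw [eLpNorm_comp_measurePreserving hbm (measurePreserving_add_right volume k), mul_assoc, two_mul]
  exact add_le_add (bound a ha) (bound b hb)

/-! ### Weak derivatives as limits of dyadic quotients -/

/-- The dyadic difference quotients of a function in `B^{α,p}_∞`, `α > 1`, converge in `Lᵖ`, with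
a quantitative control of the limit. -/
theorem MemBesov.exists_tendsto_dyadicQuotient {α : ℝ} (hα : 1 < α) {p : ℝ≥0∞} (hp : 1 ≤ p)
    {ψ : E → ℝ} (hψ : MemBesov α p ψ) (w : E) :
    ∃ g : E → ℝ, MemLp g p volume ∧
      Tendsto (fun k : ℕ => eLpNorm ((2 : ℝ) ^ k • fwdDiff (((2 : ℝ) ^ k)⁻¹ • w) ψ - g) p volume)
        atTop (𝓝 0) ∧
      eLpNorm (fwdDiff w ψ - g) p volume ≤
        ENNReal.ofReal (‖w‖ ^ α / (α - 1)) * besovSeminorm α p ψ := by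
  have : Fact (1 ≤ p) := ⟨hp⟩
  obtain ⟨hL, hS⟩ := hψ
  -- Bernoulli's inequality `1 + α ≤ 2^α`. The geometric series sums to a multiple of `1 / (2^α -
  -- 2)`, and this is where `1 / (α - 1)` comes from.
  have h2α : α - 1 ≤ (2 : ℝ) ^ α - 2 := by
    have := one_add_mul_self_le_rpow_one_add (s := 1) (by norm_num) hα.le
    norm_num at this
    linarith
  have hpos : (0 : ℝ) < 2 ^ α := by positivity
  set S := (besovSeminorm α p ψ).toReal
  have hSof : besovSeminorm α p ψ = ENNReal.ofReal S := (ENNReal.ofReal_toReal hS.ne).symm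
  have hS0 : 0 ≤ S := ENNReal.toReal_nonneg
  set D : ℕ → E → ℝ := fun k => (2 : ℝ) ^ k • fwdDiff (((2 : ℝ) ^ k)⁻¹ • w) ψ with hD
  have hDL : ∀ k, MemLp (D k) p volume := fun k => (memLp_fwdDiff hL _).const_smul _
  set F : ℕ → Lp ℝ p (volume : Measure E) := fun k => (hDL k).toLp (D k) with hF
  have hdist : ∀ k, dist (F k) (F (k + 1)) ≤ S * ‖w‖ ^ α / 2 ^ α * (2 / 2 ^ α) ^ k := by
    intro k
    set v : E := ((2 : ℝ) ^ (k + 1))⁻¹ • w with hv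
    have e : D k - D (k + 1) = (2 : ℝ) ^ k • fwdDiff v (fwdDiff v ψ) := by
      have hvv : ((2 : ℝ) ^ k)⁻¹ • w = v + v := by
        rw [hv, ← add_smul]; congr 1; rw [pow_succ]; field_simp; norm_num
      ext x
      simp only [hD, Pi.sub_apply, Pi.smul_apply, smul_eq_mul, hvv, fwdDiff, ← add_assoc]
      rw [pow_succ (2 : ℝ) k] at hv ⊢
      rw [← hv]
      ring
    have hvn : (2 : ℝ) ^ k * ‖v‖ ^ α = ‖w‖ ^ α / 2 ^ α * (2 / 2 ^ α) ^ k := by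
      have : ((2 : ℝ) ^ (k + 1)) ^ α = (2 ^ α) ^ (k + 1) := by
        rw [← Real.rpow_natCast, ← Real.rpow_mul (by norm_num), mul_comm, Real.rpow_mul (by norm_num),
          Real.rpow_natCast]
      rw [hv, norm_smul, norm_inv, norm_pow, Real.norm_ofNat,
        Real.mul_rpow (by positivity) (norm_nonneg _), Real.inv_rpow (by positivity), this, pow_succ,
        div_pow]
      field_simp
    rw [hF, dist_edist, Lp.edist_toLp_toLp, e]
    refine ENNReal.toReal_le_of_le_ofReal (by positivity) ?_
    rw [eLpNorm_const_smul, Real.enorm_of_nonneg (by positivity)]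
    refine (mul_le_mul_right (eLpNorm_fwdDiff_fwdDiff_le α p ψ v) _).trans (le_of_eq ?_)
    rw [hSof, ← mul_assoc, ← ENNReal.ofReal_mul (by positivity), ← ENNReal.ofReal_mul (by positivity),
      hvn]
    congr 1; ring
  have hr : (2 : ℝ) / 2 ^ α < 1 := by rw [div_lt_one hpos]; linarith
  obtain ⟨g, hg⟩ := cauchySeq_tendsto_of_complete (cauchySeq_of_le_geometric _ _ hr hdist)
  have hlim := dist_le_of_le_geometric_of_tendsto₀ _ _ hr hdist hg
  refine ⟨g, Lp.memLp g, ?_, ?_⟩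
  · have := (Lp.tendsto_Lp_iff_tendsto_eLpNorm'' (fi := atTop) D hDL g (Lp.memLp g)).1
    rw [Lp.toLp_coeFn] at this
    exact this hg
  -- The whole tail from `k = 0` bounds the distance of the undivided difference `δ_w ψ` from the
  -- limit.
  · have e0 : fwdDiff w ψ = D 0 := by simp [hD]
    have e1 : eLpNorm (D 0 - ⇑g) p volume = edist (F 0) g := by
      conv_rhs => rw [← Lp.toLp_coeFn g (Lp.memLp g)]
      rw [hF, Lp.edist_toLp_toLp]
    rw [e0, e1, edist_dist, hSof, ← ENNReal.ofReal_mul (by have := sub_pos.2 hα; positivity)]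
    refine ENNReal.ofReal_le_ofReal (hlim.trans ?_)
    have : S * ‖w‖ ^ α / 2 ^ α / (1 - 2 / 2 ^ α) = S * ‖w‖ ^ α / (2 ^ α - 2) := by
      rw [div_div, mul_sub, mul_one, mul_div_cancel₀ _ hpos.ne']
    rw [this, div_mul_eq_mul_div, mul_comm S]
    exact div_le_div_of_nonneg_left (by positivity) (by linarith) h2α

/-- A function in `B^{α,p}_∞`, `α > 1`, has a weak derivative in `Lᵖ` in every direction, which is
close to the difference quotient. -/
theorem MemBesov.exists_weakDeriv {α : ℝ} (hα : 1 < α) {p : ℝ≥0∞} (hp : 1 ≤ p)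
    {ψ : E → ℝ} (hψ : MemBesov α p ψ) (w : E) :
    ∃ g : E → ℝ, MemLp g p volume ∧
      (∀ φ : E → ℝ, ContDiff ℝ ∞ φ → HasCompactSupport φ →
        ∫ x, ψ x * fderiv ℝ φ x w = -∫ x, g x * φ x) ∧
      eLpNorm (fwdDiff w ψ - g) p volume ≤
        ENNReal.ofReal (‖w‖ ^ α / (α - 1)) * besovSeminorm α p ψ := by
  obtain ⟨g, hg, hlim, hle⟩ := hψ.exists_tendsto_dyadicQuotient hα hp w
  refine ⟨g, hg, fun φ hφ hc => ?_, hle⟩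
  -- Test functions lie in every Lebesgue space, so duality also covers `p = 1`, with conjugate
  -- exponent `∞`.
  have : ENNReal.HolderConjugate p p.conjExponent := .conjExponent hp
  have h1 := tendsto_integral_mul_of_tendsto_eLpNorm (q := p.conjExponent)
    (fun k : ℕ => (memLp_fwdDiff hψ.1 (((2 : ℝ) ^ k)⁻¹ • w)).const_smul ((2 : ℝ) ^ k)) hg
    (hφ.continuous.memLp_of_hasCompactSupport hc) hlim
  have ht : Tendsto (fun k : ℕ => ((2 : ℝ) ^ k)⁻¹) atTop (𝓝[>] 0) :=
    tendsto_inv_atTop_nhdsGT_zero.comp (tendsto_pow_atTop_atTop_of_one_lt one_lt_two)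
  have h2 := (tendsto_integral_differenceQuotient (hψ.1.locallyIntegrable hp) hφ hc w).comp ht
  have := tendsto_nhds_unique h1 (h2.congr fun k => by simp [fwdDiff])
  rw [this, neg_neg]

/-- Directional derivatives are determined almost everywhere by testing. This transfers the
estimates for the constructed limits to an arbitrary version of the weak gradient. -/
theorem HasWeakGradient.inner_ae_eq {ψ : E → ℝ} {G : E → E} (hG : HasWeakGradient ψ G) {w : E}
    {g : E → ℝ} (hg : LocallyIntegrable g volume)
    (h : ∀ φ : E → ℝ, ContDiff ℝ ∞ φ → HasCompactSupport φ →
      ∫ x, ψ x * fderiv ℝ φ x w = -∫ x, g x * φ x) :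
    (fun x => inner ℝ (G x) w) =ᵐ[volume] g := by
  have hGw : LocallyIntegrable (fun x => inner ℝ (G x) w) volume := by
    intro x
    obtain ⟨s, hs, hi⟩ := hG.2.1 x
    exact ⟨s, hs, Integrable.inner_const hi w⟩
  refine ae_eq_of_integral_contDiff_smul_eq hGw hg fun φ hφ hc => ?_
  have := neg_injective ((hG.2.2 φ hφ hc w).symm.trans (h φ hφ hc))
  simpa [mul_comm] using this

theorem MemBesov.eLpNorm_fwdDiff_sub_inner_le {α : ℝ} (hα : 1 < α) {p : ℝ≥0∞} (hp : 1 ≤ p)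
    {ψ : E → ℝ} (hψ : MemBesov α p ψ) {G : E → E} (hG : HasWeakGradient ψ G) (w : E) :
    MemLp (fun x => inner ℝ (G x) w) p volume ∧
      eLpNorm (fwdDiff w ψ - fun x => inner ℝ (G x) w) p volume ≤
        ENNReal.ofReal (‖w‖ ^ α / (α - 1)) * besovSeminorm α p ψ := by
  obtain ⟨g, hg, h, hle⟩ := hψ.exists_weakDeriv hα hp w
  have e := hG.inner_ae_eq (hg.locallyIntegrable hp) h
  refine ⟨hg.ae_eq e.symm, ?_⟩
  rwa [eLpNorm_congr_ae (EventuallyEq.rfl.sub e)]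

/-- A function in `B^{α,p}_∞`, `α > 1`, has a weak gradient. -/
theorem MemBesov.exists_hasWeakGradient {α : ℝ} (hα : 1 < α) {p : ℝ≥0∞} (hp : 1 ≤ p)
    {ψ : E → ℝ} (hψ : MemBesov α p ψ) : ∃ G : E → E, HasWeakGradient ψ G := by
  choose g hg h _ using fun i : Fin N =>
    hψ.exists_weakDeriv hα hp (EuclideanSpace.basisFun (Fin N) ℝ i)
  set b := EuclideanSpace.basisFun (Fin N) ℝ
  have hGL : MemLp (fun x => ∑ i, g i x • b i) p volume :=
    memLp_finsetSum _ fun i _ => (ContinuousLinearMap.toSpanSingleton ℝ (b i)).comp_memLp' (hg i)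
  refine ⟨fun x => ∑ i, g i x • b i, hψ.1.locallyIntegrable hp, hGL.locallyIntegrable hp,
    fun φ hφ hc v => ?_⟩
  have hd : ∀ i, Integrable (fun x => inner ℝ (b i) v * (ψ x * fderiv ℝ φ x (b i))) volume := by
    intro i
    refine Integrable.const_mul ?_ _
    have hs : HasCompactSupport fun x => fderiv ℝ φ x (b i) := hc.fderiv_apply ℝ (b i)
    simpa [mul_comm] using (hψ.1.locallyIntegrable hp).integrable_smul_left_of_hasCompactSupport
      ((hφ.continuous_fderiv (by simp)).clm_apply continuous_const) hs
  have hi : ∀ i, Integrable (fun x => inner ℝ (b i) v * (g i x * φ x)) volume := by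
    intro i
    refine Integrable.const_mul ?_ _
    simpa [mul_comm] using ((hg i).locallyIntegrable hp).integrable_smul_left_of_hasCompactSupport
      hφ.continuous hc
  have e1 : ∀ x, ψ x * fderiv ℝ φ x v = ∑ i, inner ℝ (b i) v * (ψ x * fderiv ℝ φ x (b i)) := by
    intro x
    conv_lhs => rw [← b.sum_repr' v]
    simp only [map_sum, map_smul, smul_eq_mul, Finset.mul_sum]
    exact Finset.sum_congr rfl fun i _ => by ring
  have e2 : ∀ x, inner ℝ (∑ i, g i x • b i) v * φ x = ∑ i, inner ℝ (b i) v * (g i x * φ x) := by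
    intro x
    simp only [sum_inner, real_inner_smul_left, Finset.sum_mul]
    exact Finset.sum_congr rfl fun i _ => by ring
  simp_rw [e1, e2]
  rw [integral_finsetSum _ fun i _ => hd i, integral_finsetSum _ fun i _ => hi i,
    ← Finset.sum_neg_distrib]
  refine Finset.sum_congr rfl fun i _ => ?_
  rw [integral_const_mul, integral_const_mul, h i φ hφ hc, mul_neg]

/-! ### Estimates for the gradient -/

/-- The `Lᵖ` norm of a vector field is at most the sum of those of its coordinates. -/
theorem eLpNorm_le_sum_inner {p : ℝ≥0∞} (hp : 1 ≤ p) {G : E → E}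
    (hG : AEStronglyMeasurable G volume) :
    eLpNorm G p volume ≤
      ∑ i, eLpNorm (fun x => inner ℝ (G x) (EuclideanSpace.basisFun (Fin N) ℝ i)) p volume := by
  set b := EuclideanSpace.basisFun (Fin N) ℝ
  have hm : ∀ i, AEStronglyMeasurable (fun x => inner ℝ (G x) (b i)) volume := fun i =>
    hG.inner aestronglyMeasurable_const
  have e : G = ∑ i, fun x => (inner ℝ (G x) (b i) : ℝ) • b i := by
    ext1 x
    conv_lhs => rw [← b.sum_repr' (G x)]
    simp [real_inner_comm]
  conv_lhs => rw [e]
  refine (eLpNorm_sum_le (fun i _ => (hm i).smul_const (b i)) hp).trans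
    (Finset.sum_le_sum fun i _ => eLpNorm_mono fun x => ?_)
  rw [norm_smul, b.norm_eq_one, mul_one]

/-- Each `∂_i ψ` is `δ_{e_i} ψ`, of norm at most `2 ‖ψ‖`, minus the error of the unit-step
difference. -/
theorem MemBesov.eLpNorm_weakGradient_le {α : ℝ} (hα : 1 < α) {p : ℝ≥0∞} (hp : 1 ≤ p)
    {ψ : E → ℝ} (hψ : MemBesov α p ψ) {G : E → E} (hG : HasWeakGradient ψ G) :
    eLpNorm G p volume ≤ N * (2 * eLpNorm ψ p volume +
      ENNReal.ofReal (1 / (α - 1)) * besovSeminorm α p ψ) := by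
  refine (eLpNorm_le_sum_inner hp hG.2.1.aestronglyMeasurable).trans ?_
  refine (Finset.sum_le_card_nsmul _ _ (2 * eLpNorm ψ p volume +
    ENNReal.ofReal (1 / (α - 1)) * besovSeminorm α p ψ) fun i _ => ?_).trans_eq
      (by rw [Finset.card_fin, nsmul_eq_mul])
  set b := EuclideanSpace.basisFun (Fin N) ℝ
  obtain ⟨hm, hle⟩ := hψ.eLpNorm_fwdDiff_sub_inner_le hα hp hG (b i)
  have hf := memLp_fwdDiff hψ.1 (b i)
  have e : (fun x => inner ℝ (G x) (b i)) =
      fwdDiff (b i) ψ - (fwdDiff (b i) ψ - fun x => inner ℝ (G x) (b i)) := by simp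
  rw [e]
  refine (eLpNorm_sub_le hf.aestronglyMeasurable (hf.sub hm).aestronglyMeasurable hp).trans ?_
  refine add_le_add (eLpNorm_fwdDiff_le hp hψ.1.aestronglyMeasurable _) ?_
  simpa [b.norm_eq_one] using hle

/-- With `w = |h| e_i`, one has `|h| δ_h ∂_i ψ = δ_h δ_w ψ - δ_h (δ_w ψ - ∂_w ψ)`. The step of `w`
matches `|h|`, so both terms are of order `|h|^α`. -/
theorem MemBesov.eLpNorm_fwdDiff_weakGradient_le {α : ℝ} (hα : 1 < α) (hα' : α < 2) {p : ℝ≥0∞}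
    (hp : 1 ≤ p) {ψ : E → ℝ} (hψ : MemBesov α p ψ) {G : E → E} (hG : HasWeakGradient ψ G) (h : E) :
    ENNReal.ofReal ‖h‖ * eLpNorm (fwdDiff h G) p volume ≤
      N * (ENNReal.ofReal (4 / (α - 1) * ‖h‖ ^ α) * besovSeminorm α p ψ) := by
  have hGm := hG.2.1.aestronglyMeasurable
  have hδ : AEStronglyMeasurable (fwdDiff h G) volume :=
    (hGm.comp_measurePreserving (measurePreserving_add_right volume h)).sub hGm
  refine (mul_le_mul_right (eLpNorm_le_sum_inner hp hδ) _).trans ?_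
  rw [Finset.mul_sum]
  refine (Finset.sum_le_card_nsmul _ _
    (ENNReal.ofReal (4 / (α - 1) * ‖h‖ ^ α) * besovSeminorm α p ψ) fun i _ => ?_).trans_eq
      (by rw [Finset.card_fin, nsmul_eq_mul])
  set b := EuclideanSpace.basisFun (Fin N) ℝ
  set w : E := ‖h‖ • b i
  have hw : ‖w‖ = ‖h‖ := by simp [w, norm_smul, b.norm_eq_one]
  obtain ⟨hm, hle⟩ := hψ.eLpNorm_fwdDiff_sub_inner_le hα hp hG w
  have hf := memLp_fwdDiff hψ.1 w
  have e1 : ENNReal.ofReal ‖h‖ * eLpNorm (fun x => inner ℝ (fwdDiff h G x) (b i)) p volume =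
      eLpNorm (fwdDiff h (fun x => inner ℝ (G x) w)) p volume := by
    rw [← Real.enorm_of_nonneg (norm_nonneg h), ← eLpNorm_const_smul]
    congr 1
    ext x
    simp [fwdDiff, w, inner_sub_left, inner_smul_right, mul_sub]
  have e2 : fwdDiff h (fun x => inner ℝ (G x) w) =
      fwdDiff h (fwdDiff w ψ) - fwdDiff h (fwdDiff w ψ - fun x => inner ℝ (G x) w) := by
    ext x; simp only [fwdDiff, Pi.sub_apply]; ring
  rw [e1, e2]
  refine (eLpNorm_sub_le (memLp_fwdDiff hf h).aestronglyMeasurable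
    (memLp_fwdDiff (hf.sub hm) h).aestronglyMeasurable hp).trans ?_
  refine (add_le_add (eLpNorm_fwdDiff_fwdDiff_le_of_norm_eq (α := α) (by linarith) hp
    hψ.1.aestronglyMeasurable hw) ((eLpNorm_fwdDiff_le hp (hf.sub hm).aestronglyMeasurable h).trans
      (mul_le_mul_right hle _))).trans ?_
  have hα0 : 0 < α - 1 := sub_pos.2 hα
  have h0 : (0 : ℝ) ≤ ‖h‖ ^ α := by positivity
  have two : ∀ r : ℝ, 2 * ENNReal.ofReal r = ENNReal.ofReal (2 * r) := fun r => by
    rw [ENNReal.ofReal_mul (by norm_num), ENNReal.ofReal_ofNat]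
  rw [hw, ← mul_assoc, ← add_mul, two, two,
    ← ENNReal.ofReal_add (by positivity) (by positivity)]
  gcongr
  rw [div_mul_eq_mul_div, mul_div_assoc', ← sub_nonneg]
  -- The two terms contribute `2 + 2 / (α - 1)`, which is at most `4 / (α - 1)` exactly when `α ≤
  -- 2`.
  have : 4 * ‖h‖ ^ α / (α - 1) - (2 * ‖h‖ ^ α + 2 * ‖h‖ ^ α / (α - 1)) =
      2 * ‖h‖ ^ α * (2 - α) / (α - 1) := by field_simp; ring
  rw [this]
  have := sub_pos.2 hα'
  positivity

theorem MemBesov.nikolskiiSeminorm_weakGradient_le {α : ℝ} (hα : 1 < α) (hα' : α < 2) {p : ℝ≥0∞}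
    (hp : 1 ≤ p) {ψ : E → ℝ} (hψ : MemBesov α p ψ) {G : E → E} (hG : HasWeakGradient ψ G) :
    nikolskiiSeminorm (α - 1) p G ≤ N * (ENNReal.ofReal (4 / (α - 1)) * besovSeminorm α p ψ) := by
  refine iSup₂_le fun h hh => ?_
  have hn : 0 < ‖h‖ := norm_pos_iff.2 hh
  have hp' : 0 < ‖h‖ ^ α := by positivity
  have e : (fun x => (‖h‖ ^ (α - 1))⁻¹ • fwdDiff h G x) = ((‖h‖ ^ α)⁻¹ * ‖h‖) • fwdDiff h G := by
    ext1 x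
    rw [Pi.smul_apply, Real.rpow_sub_one hn.ne', inv_div, div_eq_inv_mul]
  rw [e, eLpNorm_const_smul, Real.enorm_of_nonneg (by positivity),
    ENNReal.ofReal_mul (by positivity), mul_assoc]
  refine (mul_le_mul_right (hψ.eLpNorm_fwdDiff_weakGradient_le hα hα' hp hG h) _).trans
    (le_of_eq ?_)
  rw [mul_left_comm, ← mul_assoc (ENNReal.ofReal _), ← ENNReal.ofReal_mul (by positivity)]
  congr 3
  field_simp

end BesovNikolskii

/-! ### Assembly of the constants -/

theorem proposition2p3 (N : ℕ) (p : ℝ≥0∞) (hp : 1 ≤ p) (hp' : p < ⊤) :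
    ∃ C : ℝ, 0 < C ∧ ∀ α : ℝ, 1 < α → α < 2 →
      -- the continuous embedding
      (∃ K : ℝ≥0, ∀ ψ : EuclideanSpace ℝ (Fin N) → ℝ, BesovNikolskii.MemBesov α p ψ →
        BesovNikolskii.MemW1p p ψ ∧
          BesovNikolskii.sobolevNorm p ψ ≤ K * BesovNikolskii.besovNorm α p ψ) ∧
      -- the two estimates, for every version of the weak gradient
      (∀ ψ : EuclideanSpace ℝ (Fin N) → ℝ, BesovNikolskii.MemBesov α p ψ →
        ∀ G : EuclideanSpace ℝ (Fin N) → EuclideanSpace ℝ (Fin N),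
          BesovNikolskii.HasWeakGradient ψ G →
            MemLp G p volume ∧
            eLpNorm G p volume ≤ ENNReal.ofReal C * eLpNorm ψ p volume +
              ENNReal.ofReal (C / (α - 1)) * BesovNikolskii.besovSeminorm α p ψ ∧
            BesovNikolskii.nikolskiiSeminorm (α - 1) p G ≤
              ENNReal.ofReal (C / ((2 - α) * (α - 1))) *
                BesovNikolskii.besovSeminorm α p ψ) := by
  -- `4 N` is what the third estimate requires and exceeds the `2 N` and `N` of the second; the `+
  -- 1` keeps the constant positive when `N = 0`.
  refine ⟨4 * N + 1, by positivity, fun α hα hα' => ?_⟩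
  have h1 : 0 < α - 1 := sub_pos.2 hα
  have h2 : 0 < 2 - α := sub_pos.2 hα'
  have hN : (N : ℝ≥0∞) = ENNReal.ofReal N := (ENNReal.ofReal_natCast N).symm
  have grad : ∀ ψ : EuclideanSpace ℝ (Fin N) → ℝ, BesovNikolskii.MemBesov α p ψ →
      ∀ G, BesovNikolskii.HasWeakGradient ψ G →
        eLpNorm G p volume ≤ ENNReal.ofReal (4 * N + 1) * eLpNorm ψ p volume +
          ENNReal.ofReal ((4 * N + 1) / (α - 1)) * BesovNikolskii.besovSeminorm α p ψ := by
    intro ψ hψ G hG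
    refine (hψ.eLpNorm_weakGradient_le hα hp hG).trans ?_
    have two : ENNReal.ofReal N * 2 = ENNReal.ofReal (N * 2) := by
      rw [ENNReal.ofReal_mul (by positivity), ENNReal.ofReal_ofNat]
    rw [mul_add, ← mul_assoc, ← mul_assoc, hN, two,
      ← ENNReal.ofReal_mul (by positivity)]
    have hN0 : (0 : ℝ) ≤ N := by positivity
    gcongr
    · linarith
    · rw [mul_one_div]; gcongr; linarith
  have memLp : ∀ ψ : EuclideanSpace ℝ (Fin N) → ℝ, BesovNikolskii.MemBesov α p ψ →
      ∀ G, BesovNikolskii.HasWeakGradient ψ G → MemLp G p volume := fun ψ hψ G hG =>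
    ⟨hG.2.1.aestronglyMeasurable, (grad ψ hψ G hG).trans_lt (ENNReal.add_lt_top.2
      ⟨ENNReal.mul_lt_top ENNReal.ofReal_lt_top hψ.1.2,
        ENNReal.mul_lt_top ENNReal.ofReal_lt_top hψ.2⟩)⟩
  refine ⟨⟨1 + (4 * N + 1 : ℝ).toNNReal + ((4 * N + 1) / (α - 1) : ℝ).toNNReal, fun ψ hψ => ?_⟩,
    fun ψ hψ G hG => ⟨memLp ψ hψ G hG, grad ψ hψ G hG, ?_⟩⟩
  · obtain ⟨G, hG⟩ := hψ.exists_hasWeakGradient hα hp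
    refine ⟨⟨hψ.1, G, hG, memLp ψ hψ G hG⟩, ?_⟩
    rw [BesovNikolskii.sobolevNorm_eq p hG, BesovNikolskii.besovNorm]
    refine (add_le_add_right (grad ψ hψ G hG) _).trans ?_
    push_cast
    change _ ≤ (1 + ENNReal.ofReal (4 * N + 1) + ENNReal.ofReal ((4 * N + 1) / (α - 1))) * _
    set a := ENNReal.ofReal (4 * N + 1)
    set c := ENNReal.ofReal ((4 * N + 1) / (α - 1))
    set u := eLpNorm ψ p volume
    set s := BesovNikolskii.besovSeminorm α p ψ
    -- The added terms are the cross terms missing from the expansion of `(1 + a + c) (u + s)`.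
    calc u + (a * u + c * s) ≤ u + (a * u + c * s) + (c * u + (1 + a) * s) := le_self_add
      _ = (1 + a + c) * (u + s) := by ring
  · refine (hψ.nikolskiiSeminorm_weakGradient_le hα hα' hp hG).trans ?_
    rw [← mul_assoc, hN, ← ENNReal.ofReal_mul (by positivity)]
    gcongr
    rw [mul_div_assoc', mul_comm (N : ℝ)]
    refine div_le_div₀ (by positivity) (by linarith) (by positivity) ?_
    -- Since `2 - α ≤ 1`, inserting this factor in the denominator only enlarges the bound.
    exact mul_le_of_le_one_left h1.le (by linarith)
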